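/- Consider online bin packing: the input is a finite sequence $\sigma=(x_1,\dots,x_n)$ of items with sizes $x_i\in(0,1]$, each item must on arrival be placed irrevocably into a bin of capacity $1$, and the cost is the number of bins used; $\mathrm{OPT}(\sigma)$ denotes the minimum number of bins into which the items of $\sigma$ can be packed. A deterministic online algorithm with advice has access to an infinite advice tape whose content $\varphi=\varphi(\sigma)\in\{0,1\}^{\mathbb N}$ is written by an oracle that knows the whole input $\sigma$; its decision for $x_i$ is computed from $\varphi,x_1,\dots,x_i$, the tape is read sequentially from its beginning, and the packing produced must be valid. Its advice complexity at $n$ is the largest number of bits of $\varphi$ that it reads over all inputs of length at most $n$. A randomized online algorithm $R$ with advice complexity $b(n)$ is a probability distribution over deterministic online algorithms with advice complexity at most $b(n)$, and $R$ is $c$-competitive if there is a constant $\alpha$ with $\mathbb E[R(\sigma)]\le c\cdot \mathrm{OPT}(\sigma)+\alpha$ for all inputs $\sigma$. Theorem. Let $c<4-2\sqrt2$ be a constant. Then every randomized $c$-competitive bin packing algorithm must read $\Omega(n)$ bits of advice: there is a constant $\delta>0$, depending only on $c$, such that for every randomized $c$-competitive online bin packing algorithm with advice complexity $b(n)$ we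 have $b(n)\ge\delta n$ for all sufficiently large $n$ (where how large may depend on the algorithm). -/

import Mathlib

open MeasureTheory Filter

namespace BinPacking

/-- Item sizes; bins have capacity `1`. -/
abbrev Item : Type := Set.Ioc (0 : ℝ) 1

/-- The items of `σ`, the `i`-th of which is put into the bin labelled `y i`, respect the
capacity of every bin. -/
def IsPacking (σ : List Item) (y : Fin σ.length → ℕ) : Prop :=
  ∀ k : ℕ, ∑ i with y i = k, (σ.get i : ℝ) ≤ 1

/-- The number of (nonempty) bins in use. -/
def binCount {n : ℕ} (y : Fin n → ℕ) : ℕ := (Finset.univ.image y).card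

/-- The optimal offline cost. -/
noncomputable def opt (σ : List Item) : ℕ :=
  sInf {m | ∃ y : Fin σ.length → ℕ, IsPacking σ y ∧ binCount y = m}

/-- The content of an infinite advice tape. -/
abbrev Tape : Type := ℕ → Bool

/-- A deterministic online bin packing algorithm with advice, in the advice-on-tape model.

* `answer φ [x₁, …, xᵢ]` is the bin into which the last item `xᵢ` is put when the tape
  contains `φ`.
* `bitsRead φ [x₁, …, xᵢ]` is the total number of bits read from the tape `φ` (sequentially,
  from its beginning) until `xᵢ` has been packed. What the algorithm does until then, including
  how many bits it reads, depends on the tape only through the bits read.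
* `oracle σ` is the content of the tape when the complete input is `σ`.
* On every input the algorithm produces a valid packing. -/
structure OnlineAlg where
  answer : Tape → List Item → ℕ
  bitsRead : Tape → List Item → ℕ
  bitsRead_mono : ∀ (φ : Tape) (σ τ : List Item), σ <+: τ → bitsRead φ σ ≤ bitsRead φ τ
  answer_congr : ∀ (φ ψ : Tape) (σ : List Item),
    (∀ j < bitsRead φ σ, φ j = ψ j) → answer φ σ = answer ψ σ
  bitsRead_congr : ∀ (φ ψ : Tape) (σ : List Item),
    (∀ j < bitsRead φ σ, φ j = ψ j) → bitsRead φ σ = bitsRead ψ σ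
  oracle : List Item → Tape
  valid : ∀ σ : List Item,
    IsPacking σ (fun i : Fin σ.length => answer (oracle σ) (σ.take (i + 1)))

namespace OnlineAlg

/-- The packing computed on the input `σ`. -/
def output (A : OnlineAlg) (σ : List Item) : Fin σ.length → ℕ :=
  fun i => A.answer (A.oracle σ) (σ.take (i + 1))

def cost (A : OnlineAlg) (σ : List Item) : ℕ := binCount (A.output σ)

/-- The largest number of advice bits read over all inputs of length at most `n`. -/
noncomputable def adviceComplexity (A : OnlineAlg) (n : ℕ) : ℕ∞ :=
  ⨆ (σ : List Item) (_ : σ.length ≤ n), (A.bitsRead (A.oracle σ) σ : ℕ∞)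

end OnlineAlg

/-- A randomized online algorithm with advice: a probability distribution over deterministic
ones, given as a random variable `alg` on a probability space, such that the cost on each input
is a random variable. -/
structure RandomizedAlg (Ω : Type*) [MeasurableSpace Ω] where
  prob : Measure Ω
  isProbabilityMeasure : IsProbabilityMeasure prob
  alg : Ω → OnlineAlg
  measurable_cost : ∀ σ : List Item, Measurable (fun ω => (alg ω).cost σ)

namespace RandomizedAlg

variable {Ω : Type*} [MeasurableSpace Ω]

noncomputable def expectedCost (R : RandomizedAlg Ω) (σ : List Item) : ℝ :=
  ∫ ω, ((R.alg ω).cost σ : ℝ) ∂(R.prob)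

def IsCompetitive (R : RandomizedAlg Ω) (c : ℝ) : Prop :=
  ∃ α : ℝ, ∀ σ : List Item, R.expectedCost σ ≤ c * opt σ + α

/-- All algorithms of the distribution have advice complexity at most `b`. -/
def HasAdviceComplexity (R : RandomizedAlg Ω) (b : ℕ → ℕ) : Prop :=
  ∀ (ω : Ω) (n : ℕ), (R.alg ω).adviceComplexity n ≤ b n

end RandomizedAlg

end BinPacking

/-! The hard inputs are driven by `N` random labels: huge items, then `N` medium items found by
bisection, then fillers. Large medium items pair with huge items and small ones with fillers, so `N`
bins suffice offline. Online, a medium item must be packed before its label affects any size. A new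
bin opened for a large item is wasted, since no filler fits there; opening too few new bins wastes
later pairings. Weighting these two lower bounds on the cost by `1` and `q`
(`le_binCount_hardInput`, `le_cost_hardInput`) leaves an error term, `deficit`.

For a fixed tape and fixed number of huge items, and labels small with probability `1 - q`, the
deficit is a martingale with bounded steps, so its exponential moment is small
(`labelMean_exp_deficit_le`). Summing over the `2 ^ b` possible advice strings and `N + 1` huge
counts shows that advice can raise its mean only in proportion to `b`, up to small terms
(`le_labelMean_cost`). Hence with few bits the mean cost is about `(1 + q * (1 - q) / (1 + q)) * N`,
and `q = √2 - 1` makes the factor `4 - 2 * √2`. Randomization does not help, because the bound holds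
for each algorithm in the distribution (`advice_lower_bound`). -/

namespace BinPacking

/-! ### Offline packings as multisets, independent of arrival order. -/

/-- The items of the multiset `s` can be packed into `m` bins; `t` lists the items together with
the bins they are put into. -/
def Packable (s : Multiset Item) (m : ℕ) : Prop :=
  ∃ t : Multiset (Item × ℕ), t.map Prod.fst = s ∧
    (∀ k, ((t.filter fun a => a.2 = k).map fun a => (a.1 : ℝ)).sum ≤ 1) ∧
    (t.map Prod.snd).toFinset.card ≤ m

theorem Packable.zero : Packable 0 0 := ⟨0, by simp⟩

theorem Packable.cons_cons {s : Multiset Item} {m : ℕ} (h : Packable s m) {x y : Item}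
    (hxy : (x : ℝ) + y ≤ 1) : Packable (x ::ₘ y ::ₘ s) (m + 1) := by
  obtain ⟨t, rfl, ht, hc⟩ := h
  obtain ⟨k₀, hk₀⟩ := Infinite.exists_notMem_finset (t.map Prod.snd).toFinset
  refine ⟨(x, k₀) ::ₘ (y, k₀) ::ₘ t, by simp, fun k => ?_, ?_⟩
  · by_cases hk : k₀ = k
    · subst hk
      have : t.filter (fun a => a.2 = k₀) = 0 := by
        rw [Multiset.filter_eq_nil]
        intro a ha hk
        apply hk₀
        rw [Multiset.mem_toFinset, Multiset.mem_map]
        exact ⟨a, ha, hk⟩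
      simp [this, hxy]
    · simp [hk, ht k]
  · simp only [Multiset.map_cons, Multiset.toFinset_cons, Finset.insert_idem]
    exact (Finset.card_insert_le _ _).trans (by omega)

theorem opt_le_of_packable {σ : List Item} {m : ℕ} (h : Packable (σ : Multiset Item) m) :
    opt σ ≤ m := by
  obtain ⟨t, hts, ht, hc⟩ := h
  induction t using Quotient.inductionOn with | _ L₀
  -- Reorder the item-bin pairs so that their items appear in the order of `σ`.
  obtain ⟨L, rfl, hL⟩ : ∃ L : List (Item × ℕ), σ = L.map Prod.fst ∧ L.Perm L₀ := by
    change (Relation.Comp (fun x L => x = List.map Prod.fst L) List.Perm) σ L₀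
    rw [List.eq_map_comp_perm]
    exact (Multiset.coe_eq_coe.1 hts).symm
  have hLL : (Quotient.mk _ L₀ : Multiset (Item × ℕ)) = (L : Multiset _) :=
    (Multiset.coe_eq_coe.2 hL).symm
  rw [hLL] at ht hc
  let y : Fin (L.map Prod.fst).length → ℕ := fun i => (L[(i : ℕ)]'(by simpa using i.2)).2
  let e : Fin L.length ≃ Fin (L.map Prod.fst).length := finCongr (by simp)
  have hy : IsPacking (L.map Prod.fst) y := by
    intro k
    refine le_trans (le_of_eq ?_) (ht k)
    rw [Finset.sum_filter, ← e.sum_comp]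
    have : ∀ M : List (Item × ℕ), ((M.filter fun a => a.2 = k).map fun a => (a.1 : ℝ)).sum
        = (M.map fun a => if a.2 = k then (a.1 : ℝ) else 0).sum := by
      intro M
      induction M with
      | nil => simp
      | cons a M ih => by_cases h : a.2 = k <;> simp [h, ih]
    simp only [Multiset.filter_coe, Multiset.map_coe, Multiset.sum_coe, this]
    rw [← Fin.sum_univ_fun_getElem]
    simp [y, e]
  have hopt : opt (L.map Prod.fst) ≤ binCount y := Nat.sInf_le ⟨y, hy, rfl⟩
  refine hopt.trans (le_trans (le_of_eq ?_) hc)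
  unfold binCount
  congr 1
  ext k
  simp only [Finset.mem_image, Finset.mem_univ, true_and, Multiset.mem_toFinset,
    Multiset.mem_map, Multiset.mem_coe]
  constructor
  · rintro ⟨i, rfl⟩
    exact ⟨_, List.getElem_mem _, rfl⟩
  · rintro ⟨a, ha, rfl⟩
    obtain ⟨i, hi, rfl⟩ := List.mem_iff_getElem.1 ha
    exact ⟨⟨i, by simpa using hi⟩, rfl⟩

/-! ### The hard inputs. -/

/-- Lower and upper ends of the interval that contains all future medium items once the labels `l`
(newest first, `true` for small) have been revealed. -/
noncomputable def ends : List Bool → ℝ × ℝ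
  | [] => (2 / 5, 9 / 20)
  | true :: l => (((ends l).1 + (ends l).2) / 2, (ends l).2)
  | false :: l => ((ends l).1, ((ends l).1 + (ends l).2) / 2)

theorem ends_bounds (l : List Bool) :
    2 / 5 ≤ (ends l).1 ∧ (ends l).1 < (ends l).2 ∧ (ends l).2 ≤ 9 / 20 := by
  induction l with
  | nil => norm_num [ends]
  | cons b l ih => cases b <;> simp only [ends] <;> refine ⟨?_, ?_, ?_⟩ <;> linarith

noncomputable def medium (l : List Bool) : Item :=
  ⟨((ends l).1 + (ends l).2) / 2, by have := ends_bounds l; constructor <;> linarith⟩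

/-- The size is `1 - 9 / 20`, so every medium item fits beside it. -/
noncomputable def huge : Item := ⟨11 / 20, by norm_num⟩

/-- The item that complements exactly the small ones among the medium items with labels `l`. -/
noncomputable def filler (l : List Bool) : Item :=
  ⟨1 - (ends l).1, by have := ends_bounds l; constructor <;> linarith⟩

theorem huge_coe : (huge : ℝ) = 11 / 20 := rfl
theorem medium_coe (l : List Bool) : (medium l : ℝ) = ((ends l).1 + (ends l).2) / 2 := rfl
theorem filler_coe (l : List Bool) : (filler l : ℝ) = 1 - (ends l).1 := rfl

theorem ends_mono {l' l : List Bool} (h : l' <:+ l) :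
    (ends l').1 ≤ (ends l).1 ∧ (ends l).2 ≤ (ends l').2 := by
  induction l with
  | nil => rw [List.suffix_nil.1 h]; exact ⟨le_rfl, le_rfl⟩
  | cons b l ih =>
    rcases List.suffix_cons_iff.1 h with rfl | h
    · exact ⟨le_rfl, le_rfl⟩
    · have := ends_bounds l
      obtain ⟨h1, h2⟩ := ih h
      cases b <;> simp only [ends] <;> constructor <;> linarith

theorem medium_le_of_small {l' l : List Bool} (h : (true :: l') <:+ l) :
    (medium l' : ℝ) ≤ (ends l).1 := (ends_mono h).1

theorem lt_medium_of_large {l' l : List Bool} (h : (false :: l') <:+ l) :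
    (ends l).1 < medium l' :=
  (ends_bounds l).2.1.trans_le (ends_mono h).2

/-- The medium items presented for the labels `l`. -/
noncomputable def mediums : List Bool → List Item
  | [] => []
  | _ :: l => mediums l ++ [medium l]

theorem mediums_length (l : List Bool) : (mediums l).length = l.length := by
  induction l with
  | nil => rfl
  | cons b l ih => simp [mediums, ih]

theorem mediums_bounds (l : List Bool) : ∀ x ∈ mediums l, (x : ℝ) ∈ Set.Ioo (2 / 5) (9 / 20) := by
  induction l with
  | nil => simp [mediums]
  | cons b l ih =>
    have := ends_bounds l
    simp only [mediums, List.mem_append, List.mem_singleton]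
    rintro x (hx | rfl)
    · exact ih x hx
    · rw [medium_coe]; constructor <;> linarith

/-- The count `h` is a free parameter: the true number of large labels is not known from a partial
label list, and the martingale argument needs it fixed. -/
noncomputable def stem (h : ℕ) (l : List Bool) : List Item := List.replicate h huge ++ mediums l

/-- The complete input: one huge item for each large label, the medium items, and one filler for
each small label. -/
noncomputable def hardInput (l : List Bool) : List Item :=
  stem (l.count false) l ++ List.replicate (l.count true) (filler l)

theorem hardInput_length (l : List Bool) : (hardInput l).length = 2 * l.length := by
  have : l.count true + l.count false = l.length := by
    simp
  simp [hardInput, stem, mediums_length]; omega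

theorem packable_hardInput_aux (f : Item) (l : List Bool)
    (hf : ∀ l', (true :: l') <:+ l → (medium l' : ℝ) + f ≤ 1) :
    Packable ((List.replicate (l.count false) huge ++ mediums l ++
      List.replicate (l.count true) f : List Item) : Multiset Item) l.length := by
  induction l with
  | nil => simpa [mediums] using Packable.zero
  | cons b l ih =>
    have ih := ih fun l' hl' => hf l' (hl'.trans (List.suffix_cons _ _))
    cases b
    · have h := ends_bounds l
      convert ih.cons_cons (x := huge) (y := medium l) (by
        rw [huge_coe, medium_coe]; linarith) using 1
      · simp only [mediums, ← Multiset.coe_add, Multiset.coe_replicate, Multiset.coe_singleton,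
        List.count_cons_self, List.count_cons_of_ne (Bool.false_ne_true), Multiset.replicate_succ,
        ← Multiset.singleton_add]
        abel
      · rfl
    · convert ih.cons_cons (x := medium l) (y := f) (hf l (List.suffix_refl _)) using 1
      · simp only [mediums, ← Multiset.coe_add, Multiset.coe_replicate, Multiset.coe_singleton,
        List.count_cons_self, List.count_cons_of_ne (Bool.false_ne_true.symm),
        Multiset.replicate_succ, ← Multiset.singleton_add]
        abel
      · rfl

theorem opt_hardInput_le (l : List Bool) : opt (hardInput l) ≤ l.length :=
  opt_le_of_packable <| packable_hardInput_aux (filler l) l fun l' hl' => by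
    have := medium_le_of_small hl'
    rw [filler_coe]; linarith

/-! ### Counting bins in an arbitrary packing. -/

/-- Two items above `1 / 2` never share a bin, and a bin of `B` holds none of them: not from `U` by
assumption, not from `F` because its witness leaves no room. -/
theorem card_add_card_le_card_image {ι : Type*} [DecidableEq ι] {E U F : Finset ι}
    {y : ι → ℕ} {s : ι → ℝ} (hs : ∀ i ∈ E, 0 ≤ s i) (hy : ∀ k, ∑ i ∈ E with y i = k, s i ≤ 1)
    (hUE : U ⊆ E) (hFE : F ⊆ E) (hUF : Disjoint U F)
    (hU : ∀ i ∈ U, 1 / 2 < s i) (hF : ∀ i ∈ F, 1 / 2 < s i)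
    {B : Finset ℕ} (hB : ∀ k ∈ B, k ∉ U.image y ∧ ∃ i ∈ E, y i = k ∧ i ∉ F ∧
      ∀ j ∈ F, 1 < s i + s j) :
    U.card + F.card + B.card ≤ (E.image y).card := by
  have pair : ∀ i ∈ E, ∀ j ∈ E, i ≠ j → y i = y j → s i + s j ≤ 1 := by
    intro i hi j hj hij hyij
    rw [← Finset.sum_pair hij]
    refine (Finset.sum_le_sum_of_subset_of_nonneg ?_ ?_).trans (hy (y i))
    · intro k hk
      rcases Finset.mem_insert.1 hk with rfl | hk
      · simp [hi]
      · rw [Finset.mem_singleton.1 hk]; simp [hj, hyij]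
    · exact fun k hk _ => hs k (Finset.mem_filter.1 hk).1
  have big : ∀ i ∈ U ∪ F, 1 / 2 < s i := fun i hi =>
    (Finset.mem_union.1 hi).elim (hU i) (hF i)
  have hUFE : U ∪ F ⊆ E := Finset.union_subset hUE hFE
  have inj : Set.InjOn y (U ∪ F : Finset ι) := by
    intro i hi j hj hij
    by_contra hne
    have := pair i (hUFE hi) j (hUFE hj) hne hij
    have := big i hi
    have := big j hj
    linarith
  rw [← Finset.card_union_of_disjoint hUF, ← Finset.card_image_of_injOn inj,
    ← Finset.card_union_of_disjoint]
  · refine Finset.card_le_card (Finset.union_subset (Finset.image_subset_image hUFE) ?_)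
    intro k hk
    obtain ⟨-, i, hi, hik, -⟩ := hB k hk
    exact Finset.mem_image.2 ⟨i, hi, hik⟩
  · rw [Finset.disjoint_right]
    intro k hk hk'
    obtain ⟨hkU, i, hi, rfl, hiF, hij⟩ := hB k hk
    obtain ⟨j, hj, hji⟩ := Finset.mem_image.1 hk'
    rcases Finset.mem_union.1 hj with hj | hj
    · exact hkU (Finset.mem_image.2 ⟨j, hj, hji⟩)
    · have := hij j hj
      have := pair i hi j (hFE hj) (fun h => hiF (h ▸ hj)) hji.symm
      linarith

/-- Every bin holds at most two items, so count the items of `M ∪ F` bin by bin: two are possible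
only in a bin that meets `M` and avoids `U`. -/
theorem card_add_card_le_card_sdiff_add {ι : Type*} [DecidableEq ι] {E U M F : Finset ι}
    {y : ι → ℕ} {s : ι → ℝ} (hs : ∀ i ∈ E, 1 / 3 < s i)
    (hy : ∀ k, ∑ i ∈ E with y i = k, s i ≤ 1)
    (hUE : U ⊆ E) (hME : M ⊆ E) (hFE : F ⊆ E) (hUM : Disjoint U M) (hUF : Disjoint U F)
    (hMF : Disjoint M F) (hF : ∀ i ∈ F, 1 / 2 < s i) :
    M.card + F.card ≤ (M.image y \ U.image y).card + (E.image y).card := by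
  have three : ∀ C ⊆ E, ∀ k, (∀ i ∈ C, y i = k) → C.card ≤ 2 := by
    intro C hC k hk
    by_contra! h
    have h1 : C.card • (1 / 3 : ℝ) ≤ ∑ i ∈ C, s i :=
      Finset.card_nsmul_le_sum _ _ _ fun i hi => (hs i (hC hi)).le
    have h0 : ∑ i ∈ C, (1 / 3 : ℝ) < ∑ i ∈ C, s i :=
      Finset.sum_lt_sum_of_nonempty (Finset.card_pos.1 (by omega)) fun i hi => hs i (hC hi)
    have h2 : ∑ i ∈ C, s i ≤ 1 := by
      refine (Finset.sum_le_sum_of_subset_of_nonneg ?_ ?_).trans (hy k)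
      · exact fun i hi => Finset.mem_filter.2 ⟨hC hi, hk i hi⟩
      · exact fun i hi _ => (by norm_num : (0 : ℝ) ≤ 1 / 3).trans
          (hs i (Finset.mem_filter.1 hi).1).le
    have h3 : (3 : ℝ) ≤ C.card := by exact_mod_cast h
    rw [Finset.sum_const, nsmul_eq_mul] at h0
    linarith
  have hMFE : M ∪ F ⊆ E := Finset.union_subset hME hFE
  have fiber : ∀ k ∈ E.image y, ((M ∪ F).filter fun i => y i = k).card ≤
      (if k ∈ M.image y \ U.image y then 1 else 0) + 1 := by
    intro k _
    have h2 := three ((M ∪ F).filter fun i => y i = k)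
      ((Finset.filter_subset _ _).trans hMFE) k fun i hi => (Finset.mem_filter.1 hi).2
    split_ifs with h
    · exact h2
    -- Two items of `F` do not fit together, so one of the two lies in `M`; the bin then also meets
    -- `U` and would hold three items.
    by_contra! hlt
    obtain ⟨i, hi, j, hj, hij⟩ := Finset.one_lt_card.1 (by omega :
      1 < ((M ∪ F).filter fun i => y i = k).card)
    obtain ⟨hi, hik⟩ := Finset.mem_filter.1 hi
    obtain ⟨hj, hjk⟩ := Finset.mem_filter.1 hj
    have hkM : k ∈ M.image y := by
      rcases Finset.mem_union.1 hi with hi | hi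
      · exact Finset.mem_image.2 ⟨i, hi, hik⟩
      rcases Finset.mem_union.1 hj with hj | hj
      · exact Finset.mem_image.2 ⟨j, hj, hjk⟩
      exfalso
      have h1 : ∑ i ∈ {i, j}, s i ≤ 1 := by
        refine (Finset.sum_le_sum_of_subset_of_nonneg ?_ ?_).trans (hy k)
        · intro a ha
          rcases Finset.mem_insert.1 ha with rfl | ha
          · simp [hFE hi, hik]
          · rw [Finset.mem_singleton.1 ha]; simp [hFE hj, hjk]
        · exact fun i hi _ => (by norm_num : (0 : ℝ) ≤ 1 / 3).trans
            (hs i (Finset.mem_filter.1 hi).1).le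
      rw [Finset.sum_pair hij] at h1
      have := hF i hi
      have := hF j hj
      linarith
    have hkU : k ∈ U.image y := by
      by_contra hkU
      exact h (Finset.mem_sdiff.2 ⟨hkM, hkU⟩)
    obtain ⟨u, hu, huk⟩ := Finset.mem_image.1 hkU
    have huMF : u ∉ M ∪ F := fun h => (Finset.mem_union.1 h).elim
      (Finset.disjoint_left.1 hUM hu) (Finset.disjoint_left.1 hUF hu)
    have := three {u, i, j} (by
      intro a ha
      simp only [Finset.mem_insert, Finset.mem_singleton] at ha
      rcases ha with rfl | rfl | rfl
      exacts [hUE hu, hMFE hi, hMFE hj]) k (by simp [huk, hik, hjk])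
    rw [Finset.card_eq_three.2 ⟨u, i, j, fun h => huMF (h ▸ hi), fun h => huMF (h ▸ hj), hij,
      rfl⟩] at this
    omega
  rw [← Finset.card_union_of_disjoint hMF, Finset.card_eq_sum_card_fiberwise (f := y)
    (t := E.image y) fun i hi => Finset.mem_image_of_mem y (hMFE hi)]
  refine (Finset.sum_le_sum fiber).trans ?_
  rw [Finset.sum_add_distrib, ← Finset.card_filter, Finset.sum_const, smul_eq_mul, mul_one]
  gcongr
  intro k hk
  exact (Finset.mem_filter.1 hk).2

/-! ### The algorithm run on a fixed tape. -/

namespace OnlineAlg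

variable (A : OnlineAlg) (φ : Tape)

/-- The bins used for `σ` when the tape contains `φ`. -/
def used (σ : List Item) : Finset ℕ :=
  (Finset.range σ.length).image fun i => A.answer φ (σ.take (i + 1))

variable {A φ}

theorem used_prefix {τ σ : List Item} (h : τ <+: σ) :
    A.used φ τ = (Finset.range τ.length).image fun i => A.answer φ (σ.take (i + 1)) := by
  refine Finset.image_congr fun i hi => ?_
  obtain ⟨ρ, rfl⟩ := h
  have : i + 1 ≤ τ.length := Finset.mem_range.1 hi
  simp only [List.take_append_of_le_length this]

theorem used_concat (σ : List Item) (x : Item) :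
    A.used φ (σ ++ [x]) = insert (A.answer φ (σ ++ [x])) (A.used φ σ) := by
  rw [used_prefix (List.prefix_append σ [x]), used]
  simp only [List.length_append, List.length_singleton, Finset.range_add_one, Finset.image_insert]
  rw [List.take_of_length_le (by simp)]

variable (A φ)

/-- The bin chosen for the medium item that follows the labels `l`. -/
noncomputable def choice (h : ℕ) (l : List Bool) : ℕ := A.answer φ (stem h l ++ [medium l])

/-- The bins that were opened for a large medium item. -/
noncomputable def badBins (h : ℕ) : List Bool → Finset ℕ
  | [] => ∅
  | b :: l => if b = false ∧ A.choice φ h l ∉ A.used φ (stem h l) then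
      insert (A.choice φ h l) (badBins h l) else badBins h l

/-- The number of bins opened for large medium items falls short of the fraction `q` of all bins
opened for medium items by this amount. -/
noncomputable def deficit (h : ℕ) (q : ℝ) (l : List Bool) : ℝ :=
  q * ((A.used φ (stem h l)).card - (A.used φ (stem h [])).card) - (A.badBins φ h l).card

variable {A φ}

theorem used_stem_cons (h : ℕ) (b : Bool) (l : List Bool) :
    A.used φ (stem h (b :: l)) = insert (A.choice φ h l) (A.used φ (stem h l)) := by
  have : stem h (b :: l) = stem h l ++ [medium l] := by simp [stem, mediums]
  rw [this, used_concat, choice]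

theorem stem_nil_prefix (h : ℕ) (l : List Bool) : stem h [] <+: stem h l := by
  simp [stem, mediums]

theorem used_mono {τ σ : List Item} (h : τ <+: σ) : A.used φ τ ⊆ A.used φ σ := by
  rw [used_prefix h, used]
  exact Finset.image_subset_image (Finset.range_mono h.length_le)

theorem badBins_subset (h : ℕ) (l : List Bool) : A.badBins φ h l ⊆ A.used φ (stem h l) := by
  induction l with
  | nil => simp [badBins]
  | cons b l ih =>
    rw [used_stem_cons, badBins]
    split_ifs
    · exact Finset.insert_subset_insert _ ih
    · exact ih.trans (Finset.subset_insert _ _)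

theorem mem_badBins {h : ℕ} {l : List Bool} {k : ℕ} (hk : k ∈ A.badBins φ h l) :
    k ∉ A.used φ (stem h []) ∧ ∃ l', (false :: l') <:+ l ∧ A.choice φ h l' = k := by
  induction l with
  | nil => simp [badBins] at hk
  | cons b l ih =>
    have old : k ∈ A.badBins φ h l → k ∉ A.used φ (stem h []) ∧
        ∃ l', (false :: l') <:+ (b :: l) ∧ A.choice φ h l' = k := fun hk => by
      obtain ⟨h0, l', hl', hk'⟩ := ih hk
      exact ⟨h0, l', hl'.trans (List.suffix_cons _ _), hk'⟩
    rw [badBins] at hk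
    split_ifs at hk with hb
    · rcases Finset.mem_insert.1 hk with rfl | hk
      · obtain ⟨rfl, hb⟩ := hb
        exact ⟨fun h0 => hb (used_mono (stem_nil_prefix h l) h0), l, List.suffix_refl _, rfl⟩
      · exact old hk
    · exact old hk

theorem deficit_nil (h : ℕ) (q : ℝ) : A.deficit φ h q [] = 0 := by
  simp [deficit, badBins]

/-- The bin is chosen from `h` and the earlier labels `l` alone, so `b` only decides the sign of the
step; if `b` is `true` with probability `1 - q`, the step has mean zero. -/
theorem deficit_cons (h : ℕ) (q : ℝ) (b : Bool) (l : List Bool) :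
    A.deficit φ h q (b :: l) = A.deficit φ h q l +
      if A.choice φ h l ∈ A.used φ (stem h l) then 0 else if b then q else q - 1 := by
  unfold deficit
  rw [used_stem_cons, badBins]
  by_cases hn : A.choice φ h l ∈ A.used φ (stem h l)
  · simp [hn]
  · have hn' : A.choice φ h l ∉ A.badBins φ h l := fun h' => hn (badBins_subset h l h')
    cases b <;> simp [hn, hn', Finset.card_insert_of_notMem] <;> ring

theorem stem_length (h : ℕ) (l : List Bool) : (stem h l).length = h + l.length := by
  simp [stem, mediums_length]

theorem mediums_prefix {l' l : List Bool} (h : l' <:+ l) : mediums l' <+: mediums l := by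
  induction l with
  | nil => rw [List.suffix_nil.1 h]
  | cons b l ih =>
    rcases List.suffix_cons_iff.1 h with rfl | h
    · exact List.prefix_refl _
    · exact (ih h).trans (by simp [mediums])

theorem stem_concat_prefix {b : Bool} {l' l : List Bool} (h : (b :: l') <:+ l) (n : ℕ) :
    stem n l' ++ [medium l'] <+: stem n l := by
  have : stem n l' ++ [medium l'] = stem n (b :: l') := by simp [stem, mediums]
  rw [this, stem, stem]
  exact (List.prefix_append_right_inj _).2 (mediums_prefix h)

/-- Lower bounds for the number of bins in any packing computed on the hard input. -/
theorem le_binCount_hardInput (l : List Bool)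
    (hp : IsPacking (hardInput l)
      (fun i : Fin (hardInput l).length => A.answer φ ((hardInput l).take (i + 1)))) :
    l.length + (A.badBins φ (l.count false) l).card ≤
      binCount (fun i : Fin (hardInput l).length => A.answer φ ((hardInput l).take (i + 1))) ∧
    l.length + l.count true + (A.used φ (stem (l.count false) [])).card ≤
      (A.used φ (stem (l.count false) l)).card +
      binCount (fun i : Fin (hardInput l).length => A.answer φ ((hardInput l).take (i + 1))) := by
  have hlen := hardInput_length l
  have hcount : l.count true + l.count false = l.length := by simp
  set σ := hardInput l with hσ
  set h := l.count false
  set N := l.length with hN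
  set S := l.count true
  have hpre : stem h l <+: σ := List.prefix_append _ _
  have hpre0 : stem h [] <+: σ := (stem_nil_prefix h l).trans hpre
  have hsl : (stem h l).length = h + N := stem_length h l
  let y : ℕ → ℕ := fun i => A.answer φ (σ.take (i + 1))
  let s : ℕ → ℝ := fun i => if hi : i < σ.length then (σ[i] : ℝ) else 0
  have hsi : ∀ i (hi : i < σ.length), s i = σ[i] := fun i hi => dif_pos hi
  have hcost : binCount (fun i : Fin σ.length => A.answer φ (σ.take (i + 1))) =
      ((Finset.range (2 * N)).image y).card := by
    unfold binCount
    congr 1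
    ext k
    simp [Fin.exists_iff, y, hlen]
  have hpack : ∀ k, ∑ i ∈ Finset.range (2 * N) with y i = k, s i ≤ 1 := by
    intro k
    refine le_trans (le_of_eq ?_) (hp k)
    rw [Finset.sum_filter, Finset.sum_filter, ← hlen,
      ← Fin.sum_univ_eq_sum_range (fun i => if y i = k then s i else 0)]
    refine Finset.sum_congr rfl fun i _ => ?_
    simp [y, hsi i i.2]
  have hU : ∀ i ∈ Finset.range h, s i = 11 / 20 := by
    intro i hi
    have hi := Finset.mem_range.1 hi
    rw [hsi i (by omega)]
    simp only [hσ, hardInput]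
    rw [List.getElem_append_left (by rw [hsl]; omega)]
    simp only [stem]
    rw [List.getElem_append_left (by simpa using hi)]
    simp [huge_coe]
  have hM : ∀ i ∈ Finset.Ico h (h + N), 2 / 5 < s i := by
    intro i hi
    have hi := Finset.mem_Ico.1 hi
    rw [hsi i (by omega)]
    simp only [hσ, hardInput]
    rw [List.getElem_append_left (by rw [hsl]; omega)]
    simp only [stem]
    rw [List.getElem_append_right (by simpa using hi.1)]
    exact (mediums_bounds l _ (List.getElem_mem _)).1
  have hF : ∀ i ∈ Finset.Ico (h + N) (2 * N), s i = filler l := by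
    intro i hi
    have hi := Finset.mem_Ico.1 hi
    rw [hsi i (by omega)]
    simp only [hσ, hardInput]
    rw [List.getElem_append_right (by rw [hsl]; omega)]
    simp
  have hends := ends_bounds l
  have hF' : ∀ i ∈ Finset.Ico (h + N) (2 * N), 1 / 2 < s i := by
    intro i hi
    rw [hF i hi, filler_coe]; linarith
  have hU' : ∀ i ∈ Finset.range h, 1 / 2 < s i := by
    intro i hi
    rw [hU i hi]; norm_num
  have hE : ∀ i ∈ Finset.range (2 * N), 1 / 3 < s i := by
    intro i hi
    have hi := Finset.mem_range.1 hi
    rcases lt_or_ge i h with h1 | h1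
    · have := hU' i (Finset.mem_range.2 h1); linarith
    rcases lt_or_ge i (h + N) with h2 | h2
    · have := hM i (Finset.mem_Ico.2 ⟨h1, h2⟩); linarith
    · have := hF' i (Finset.mem_Ico.2 ⟨h2, hi⟩); linarith
  have hu : A.used φ (stem h l) = (Finset.range (h + N)).image y := by
    rw [used_prefix hpre, hsl]
  have hu0 : A.used φ (stem h []) = (Finset.range h).image y := by
    rw [used_prefix hpre0, stem_length]; rfl
  have hUE : Finset.range h ⊆ Finset.range (2 * N) := Finset.range_mono (by omega)
  have hME : Finset.Ico h (h + N) ⊆ Finset.range (2 * N) := fun i hi => by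
    rw [Finset.mem_Ico] at hi; rw [Finset.mem_range]; omega
  have hFE : Finset.Ico (h + N) (2 * N) ⊆ Finset.range (2 * N) := fun i hi => by
    rw [Finset.mem_Ico] at hi; rw [Finset.mem_range]; omega
  have hUM : Disjoint (Finset.range h) (Finset.Ico h (h + N)) := by
    rw [Finset.disjoint_left]; intro i hi hi'
    rw [Finset.mem_range] at hi; rw [Finset.mem_Ico] at hi'; omega
  have hUF : Disjoint (Finset.range h) (Finset.Ico (h + N) (2 * N)) := by
    rw [Finset.disjoint_left]; intro i hi hi'
    rw [Finset.mem_range] at hi; rw [Finset.mem_Ico] at hi'; omega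
  have hMF : Disjoint (Finset.Ico h (h + N)) (Finset.Ico (h + N) (2 * N)) := by
    rw [Finset.disjoint_left]; intro i hi hi'
    rw [Finset.mem_Ico] at hi hi'; omega
  have hbad : ∀ k ∈ A.badBins φ h l, k ∉ (Finset.range h).image y ∧
      ∃ i ∈ Finset.range (2 * N), y i = k ∧ i ∉ Finset.Ico (h + N) (2 * N) ∧
        ∀ j ∈ Finset.Ico (h + N) (2 * N), 1 < s i + s j := by
    intro k hk
    obtain ⟨h0, l', hl', rfl⟩ := mem_badBins hk
    have hll : l'.length + 1 ≤ N := by simpa using hl'.length_le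
    have hpre' := (stem_concat_prefix hl' h).trans hpre
    have htake : σ.take (h + l'.length + 1) = stem h l' ++ [medium l'] := by
      have := List.prefix_iff_eq_take.1 hpre'
      rw [this]
      simp [stem_length]
    have hget : s (h + l'.length) = medium l' := by
      rw [hsi _ (by omega)]
      congr 1
      rw [← hpre'.getElem (i := h + l'.length) (by simp [stem_length])]
      rw [List.getElem_append_right (by rw [stem_length])]
      simp [stem_length]
    refine ⟨hu0 ▸ h0, h + l'.length, Finset.mem_range.2 (by omega), ?_, ?_, ?_⟩
    · simp only [y, htake]; rfl
    · rw [Finset.mem_Ico]; omega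
    · intro j hj
      rw [hF j hj, hget, filler_coe]
      have := lt_medium_of_large hl'
      linarith
  rw [hcost]
  constructor
  -- Huge items and fillers number `N` together, and bad bins hold neither.
  · have := card_add_card_le_card_image
      (fun i hi => (by norm_num : (0 : ℝ) ≤ 1 / 3).trans (hE i hi).le)
      hpack hUE hFE hUF hU' hF' hbad
    rw [Finset.card_range, Nat.card_Ico] at this
    omega
  · have := card_add_card_le_card_sdiff_add hE hpack hUE hME hFE hUM hUF hMF hF'
    rw [Nat.card_Ico, Nat.card_Ico] at this
    -- A bin with a medium item and no huge item was opened during the medium phase.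
    have hsub : (Finset.Ico h (h + N)).image y \ (Finset.range h).image y ⊆
        A.used φ (stem h l) \ A.used φ (stem h []) := by
      rw [hu, hu0]
      refine Finset.sdiff_subset_sdiff (Finset.image_subset_image fun i hi => ?_) subset_rfl
      rw [Finset.mem_Ico] at hi; rw [Finset.mem_range]; omega
    have hc := Finset.card_le_card hsub
    have hs := Finset.card_sdiff_add_card_eq_card
      (used_mono (A := A) (φ := φ) (stem_nil_prefix h l))
    omega

end OnlineAlg

/-! ### Random labels and exponential moments. -/

/-- The expectation of `F` over `n` independent labels, each of which is `true` with
probability `p`. -/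
noncomputable def labelMean (p : ℝ) : ℕ → (List Bool → ℝ) → ℝ
  | 0, F => F []
  | n + 1, F => labelMean p n fun l => p * F (true :: l) + (1 - p) * F (false :: l)

section labelMean

variable {p : ℝ}

theorem labelMean_mono (h0 : 0 ≤ p) (h1 : p ≤ 1) {n : ℕ} {F G : List Bool → ℝ}
    (h : ∀ l, l.length = n → F l ≤ G l) : labelMean p n F ≤ labelMean p n G := by
  induction n generalizing F G with
  | zero => exact h [] rfl
  | succ n ih =>
    refine ih fun l hl => ?_
    have h2 : 0 ≤ 1 - p := by linarith
    have h3 := h (true :: l) (by simp [hl])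
    have h4 := h (false :: l) (by simp [hl])
    gcongr

theorem labelMean_const (n : ℕ) (a : ℝ) : labelMean p n (fun _ => a) = a := by
  induction n with
  | zero => rfl
  | succ n ih => rw [labelMean, show p * a + (1 - p) * a = a by ring, ih]

theorem labelMean_add (n : ℕ) (F G : List Bool → ℝ) :
    labelMean p n (fun l => F l + G l) = labelMean p n F + labelMean p n G := by
  induction n generalizing F G with
  | zero => rfl
  | succ n ih =>
    simp only [labelMean]
    rw [← ih]
    congr 1; ext l; ring

theorem labelMean_const_mul (n : ℕ) (a : ℝ) (F : List Bool → ℝ) :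
    labelMean p n (fun l => a * F l) = a * labelMean p n F := by
  induction n generalizing F with
  | zero => rfl
  | succ n ih =>
    simp only [labelMean]
    rw [← ih]
    congr 1; ext l; ring

theorem labelMean_sum {ι : Type*} (s : Finset ι) (n : ℕ) (F : ι → List Bool → ℝ) :
    labelMean p n (fun l => ∑ i ∈ s, F i l) = ∑ i ∈ s, labelMean p n (F i) := by
  classical
  induction s using Finset.induction_on with
  | empty => simpa using labelMean_const n 0
  | insert i s hi ih => simp only [Finset.sum_insert hi, labelMean_add, ih]

theorem labelMean_count (n : ℕ) : labelMean p n (fun l => (l.count true : ℝ)) = p * n := by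
  induction n with
  | zero => simp [labelMean]
  | succ n ih =>
    have : (fun l : List Bool => p * ((true :: l).count true : ℝ) +
        (1 - p) * ((false :: l).count true : ℝ)) = fun l => (l.count true : ℝ) + p := by
      ext l; simp; ring
    rw [labelMean, this, labelMean_add, ih, labelMean_const]
    push_cast; ring

theorem integral_labelMean {Ω : Type*} [MeasurableSpace Ω] {μ : Measure Ω} (n : ℕ)
    {F : Ω → List Bool → ℝ} (hF : ∀ l, Integrable (fun ω => F ω l) μ) :
    Integrable (fun ω => labelMean p n (F ω)) μ ∧
      ∫ ω, labelMean p n (F ω) ∂μ = labelMean p n fun l => ∫ ω, F ω l ∂μ := by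
  induction n generalizing F with
  | zero => exact ⟨hF [], rfl⟩
  | succ n ih =>
    simp only [labelMean]
    have := ih (F := fun ω l => p * F ω (true :: l) + (1 - p) * F ω (false :: l)) fun l =>
      ((hF _).const_mul _).add ((hF _).const_mul _)
    refine ⟨this.1, this.2.trans ?_⟩
    congr 1; ext l
    rw [integral_add ((hF _).const_mul _) ((hF _).const_mul _), integral_const_mul,
      integral_const_mul]

end labelMean

theorem exp_le_one_add_add_sq {x : ℝ} (hx : |x| ≤ 1) : Real.exp x ≤ 1 + x + x ^ 2 := by
  have := (abs_le.1 (Real.abs_exp_sub_one_sub_id_le hx)).2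
  linarith

/-- The linear terms cancel, and the quadratic ones add up to `t ^ 2 * q * (1 - q)`. -/
theorem bernoulli_mgf_le {q t : ℝ} (hq0 : 0 ≤ q) (hq1 : q ≤ 1) (ht0 : 0 ≤ t) (ht1 : t ≤ 1) :
    (1 - q) * Real.exp (t * q) + q * Real.exp (t * (q - 1)) ≤ 1 + t ^ 2 := by
  have h1 := exp_le_one_add_add_sq (x := t * q) (by
    rw [abs_le]; constructor <;> nlinarith [mul_nonneg ht0 hq0])
  have h2 := exp_le_one_add_add_sq (x := t * (q - 1)) (by
    rw [abs_le]; constructor <;> nlinarith [mul_nonneg ht0 (sub_nonneg.2 hq1)])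
  have h3 := mul_le_mul_of_nonneg_left h1 (sub_nonneg.2 hq1)
  have h4 := mul_le_mul_of_nonneg_left h2 hq0
  have h5 : (1 - q) * q ≤ 1 := by nlinarith
  have h6 := mul_le_mul_of_nonneg_left h5 (sq_nonneg t)
  nlinarith

/-! ### Mean cost of a deterministic algorithm with `b` bits of advice. -/

namespace OnlineAlg

variable {A : OnlineAlg}

theorem labelMean_exp_deficit_le (φ : Tape) (h : ℕ) {q t : ℝ} (hq0 : 0 ≤ q) (hq1 : q ≤ 1)
    (ht0 : 0 ≤ t) (ht1 : t ≤ 1) (n : ℕ) :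
    labelMean (1 - q) n (fun l => Real.exp (t * A.deficit φ h q l)) ≤ (1 + t ^ 2) ^ n := by
  induction n with
  | zero => simp [labelMean, deficit_nil]
  | succ n ih =>
    rw [labelMean]
    have step : ∀ l : List Bool, l.length = n →
        (1 - q) * Real.exp (t * A.deficit φ h q (true :: l)) +
          (1 - (1 - q)) * Real.exp (t * A.deficit φ h q (false :: l)) ≤
        (1 + t ^ 2) * Real.exp (t * A.deficit φ h q l) := by
      intro l _
      simp only [deficit_cons, if_true, Bool.false_eq_true, if_false]
      split_ifs
      · simp only [add_zero]
        nlinarith [Real.exp_pos (t * A.deficit φ h q l), sq_nonneg t]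
      · have := mul_le_mul_of_nonneg_right (bernoulli_mgf_le hq0 hq1 ht0 ht1)
          (Real.exp_pos (t * A.deficit φ h q l)).le
        rw [mul_add, mul_add, Real.exp_add, Real.exp_add]
        linarith
    refine (labelMean_mono (by linarith) (by linarith) step).trans ?_
    rw [labelMean_const_mul, pow_succ' (1 + t ^ 2)]
    exact mul_le_mul_of_nonneg_left ih (by positivity)

/-- The tape with the content `w`, followed by zeros. -/
def padTape {b : ℕ} (w : Fin b → Bool) : Tape := fun j => if h : j < b then w ⟨j, h⟩ else false

theorem answer_padTape {σ τ : List Item} {b : ℕ} (hb : A.bitsRead (A.oracle σ) σ ≤ b)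
    (h : τ <+: σ) :
    A.answer (A.oracle σ) τ = A.answer (padTape fun j : Fin b => A.oracle σ j) τ := by
  refine A.answer_congr _ _ _ fun j hj => ?_
  have : j < b := hj.trans_le ((A.bitsRead_mono _ _ _ h).trans hb)
  simp [padTape, this]

/-- Only the first `b` bits matter, so the oracle's tape can be replaced by one of finitely many.
The bound is the first estimate of `le_binCount_hardInput` plus `q` times the second. -/
theorem le_cost_hardInput {b : ℕ} {q : ℝ} (hq0 : 0 ≤ q) (l : List Bool)
    (hb : A.bitsRead (A.oracle (hardInput l)) (hardInput l) ≤ b) :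
    ∃ w : Fin b → Bool, (1 + q) * l.length + q * l.count true ≤
      (1 + q) * A.cost (hardInput l) + A.deficit (padTape w) (l.count false) q l := by
  refine ⟨fun j => A.oracle (hardInput l) j, ?_⟩
  set φ : Tape := padTape fun j : Fin b => A.oracle (hardInput l) j
  have hout : A.output (hardInput l) =
      fun i : Fin (hardInput l).length => A.answer φ ((hardInput l).take (i + 1)) := by
    ext i
    exact answer_padTape hb (List.take_prefix _ _)
  have hv : IsPacking (hardInput l) (A.output (hardInput l)) := A.valid (hardInput l)
  rw [hout] at hv
  obtain ⟨h1, h2⟩ := le_binCount_hardInput l hv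
  rw [← hout] at h1 h2
  change _ ≤ A.cost (hardInput l) at h1
  change _ ≤ _ + A.cost (hardInput l) at h2
  have h1' : (l.length : ℝ) + (A.badBins φ (l.count false) l).card ≤ A.cost (hardInput l) := by
    exact_mod_cast h1
  have h2' : (l.length : ℝ) + l.count true + (A.used φ (stem (l.count false) [])).card ≤
      (A.used φ (stem (l.count false) l)).card + A.cost (hardInput l) := by
    exact_mod_cast h2
  have h3 := mul_le_mul_of_nonneg_left h2' hq0
  unfold deficit
  linarith

theorem le_labelMean_cost {b N : ℕ} {q t : ℝ} (hq0 : 0 ≤ q) (hq1 : q ≤ 1)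
    (ht0 : 0 ≤ t) (ht1 : t ≤ 1)
    (hb : ∀ σ : List Item, σ.length ≤ 2 * N → A.bitsRead (A.oracle σ) σ ≤ b) :
    t * ((1 + q) * N + q * ((1 - q) * N)) ≤
      t * (1 + q) * labelMean (1 - q) N (fun l => (A.cost (hardInput l) : ℝ)) +
        (Real.log (N + 1) + b * Real.log 2 + t ^ 2 * N) := by
  set Z : ℝ := (N + 1) * 2 ^ b * (1 + t ^ 2) ^ N with hZ
  have hZ0 : 0 < Z := by positivity
  have hlogZ : Real.log Z ≤ Real.log (N + 1) + b * Real.log 2 + t ^ 2 * N := by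
    rw [hZ, Real.log_mul (by positivity) (by positivity),
      Real.log_mul (by positivity) (by positivity), Real.log_pow, Real.log_pow]
    have := Real.log_le_sub_one_of_pos (show 0 < 1 + t ^ 2 by positivity)
    have := mul_le_mul_of_nonneg_left this (Nat.cast_nonneg (α := ℝ) N)
    linarith
  -- Both the advice and the number of huge items depend on all labels, so the sum runs over every
  -- possible pair.
  let G : List Bool → ℝ := fun l => ∑ a ∈ Finset.range (N + 1) ×ˢ
    (Finset.univ : Finset (Fin b → Bool)), Real.exp (t * A.deficit (padTape a.2) a.1 q l)
  have hG : labelMean (1 - q) N G ≤ Z := by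
    simp only [G]
    rw [labelMean_sum]
    refine (Finset.sum_le_card_nsmul _ _ _ fun a _ =>
      labelMean_exp_deficit_le (padTape a.2) a.1 hq0 hq1 ht0 ht1 N).trans (le_of_eq ?_)
    simp [hZ]
  have hpt : ∀ l : List Bool, l.length = N →
      t * ((1 + q) * N) + t * q * l.count true ≤
        t * (1 + q) * A.cost (hardInput l) + (Z⁻¹ * G l + (Real.log Z - 1)) := by
    intro l hl
    obtain ⟨w, hw⟩ := le_cost_hardInput hq0 l (hb (hardInput l) (by rw [hardInput_length, hl]))
    rw [hl] at hw
    set D := A.deficit (padTape w) (l.count false) q l with hD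
    have h1 : Real.exp (t * D) ≤ G l := by
      refine Finset.single_le_sum (f := fun a : ℕ × (Fin b → Bool) =>
        Real.exp (t * A.deficit (padTape a.2) a.1 q l)) (fun a _ => (Real.exp_pos _).le)
        (a := (l.count false, w)) ?_
      have := List.count_le_length (a := false) (l := l)
      simp only [Finset.mem_product, Finset.mem_range, Finset.mem_univ, and_true]
      omega
    -- The tangent to `exp` at `log Z` linearizes the moment bound; after averaging it gives a mean
    -- of `t * D` of at most `log Z`.
    have h2 : t * D - Real.log Z + 1 ≤ Z⁻¹ * Real.exp (t * D) := by
      have := Real.add_one_le_exp (t * D - Real.log Z)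
      rwa [Real.exp_sub, Real.exp_log hZ0, div_eq_inv_mul] at this
    have h3 := mul_le_mul_of_nonneg_left h1 (inv_nonneg.2 hZ0.le)
    have h4 := mul_le_mul_of_nonneg_left hw ht0
    linarith
  have hmean := labelMean_mono (p := 1 - q) (by linarith) (by linarith) hpt
  rw [labelMean_add, labelMean_add, labelMean_add, labelMean_const, labelMean_const,
    labelMean_const_mul, labelMean_const_mul, labelMean_const_mul, labelMean_count] at hmean
  have h5 : Z⁻¹ * labelMean (1 - q) N G ≤ 1 := by
    rw [inv_mul_le_iff₀ hZ0]; linarith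
  linarith

theorem cost_le_length (σ : List Item) : A.cost σ ≤ σ.length := by
  unfold cost binCount
  exact Finset.card_image_le.trans (by simp)

end OnlineAlg

/-! ### Passing to randomized algorithms. -/

namespace RandomizedAlg

variable {Ω : Type*} [MeasurableSpace Ω] {R : RandomizedAlg Ω}

theorem integrable_cost (R : RandomizedAlg Ω) (σ : List Item) :
    Integrable (fun ω => ((R.alg ω).cost σ : ℝ)) R.prob := by
  have := R.isProbabilityMeasure
  refine Integrable.of_bound
    (measurable_from_top.comp (R.measurable_cost σ)).aestronglyMeasurable (σ.length : ℝ)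
    (Eventually.of_forall fun ω => ?_)
  simpa using OnlineAlg.cost_le_length σ

theorem bitsRead_le {b : ℕ → ℕ} (h : R.HasAdviceComplexity b) (ω : Ω) {n : ℕ} {σ : List Item}
    (hσ : σ.length ≤ n) : (R.alg ω).bitsRead ((R.alg ω).oracle σ) σ ≤ b n := by
  have h1 : (((R.alg ω).bitsRead ((R.alg ω).oracle σ) σ : ℕ) : ℕ∞) ≤ b n :=
    (le_iSup₂ (f := fun (σ : List Item) (_ : σ.length ≤ n) =>
      (((R.alg ω).bitsRead ((R.alg ω).oracle σ) σ : ℕ) : ℕ∞)) σ hσ).trans (h ω n)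
  exact_mod_cast h1

/-- The number of advice bits of a competitive algorithm, in terms of the parameters of the
distribution of labels and of the exponential moment. -/
theorem advice_lower_bound {c α q t : ℝ} (hc : 0 ≤ c)
    (hR : ∀ σ, R.expectedCost σ ≤ c * opt σ + α) {b : ℕ → ℕ} (hb : R.HasAdviceComplexity b)
    (hq0 : 0 ≤ q) (hq1 : q ≤ 1) (ht0 : 0 ≤ t) (ht1 : t ≤ 1) {N n : ℕ} (hN : 2 * N ≤ n) :
    t * ((1 + q) * N + q * ((1 - q) * N)) ≤ t * (1 + q) * (c * N + α) +
      (Real.log (N + 1) + b n * Real.log 2 + t ^ 2 * N) := by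
  have := R.isProbabilityMeasure
  obtain ⟨hint, heq⟩ := integral_labelMean (p := 1 - q) (μ := R.prob) N
    (F := fun ω l => ((R.alg ω).cost (hardInput l) : ℝ)) fun l => R.integrable_cost (hardInput l)
  have hupper : labelMean (1 - q) N (fun l => R.expectedCost (hardInput l)) ≤ c * N + α := by
    refine (labelMean_mono (G := fun _ => c * N + α) (by linarith) (by linarith)
      fun l hl => (hR _).trans ?_).trans_eq (labelMean_const _ _)
    have : (opt (hardInput l) : ℝ) ≤ N := by exact_mod_cast hl ▸ opt_hardInput_le l
    gcongr
  set K := t * ((1 + q) * N + q * ((1 - q) * N))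
  set J := Real.log (N + 1) + b n * Real.log 2 + t ^ 2 * N
  have hω : ∀ ω, K ≤ t * (1 + q) *
      labelMean (1 - q) N (fun l => ((R.alg ω).cost (hardInput l) : ℝ)) + J := fun ω =>
    OnlineAlg.le_labelMean_cost hq0 hq1 ht0 ht1 fun σ hσ => bitsRead_le hb ω (hσ.trans hN)
  clear_value K J
  have hI := integral_mono (μ := R.prob) (integrable_const K)
    ((hint.const_mul (t * (1 + q))).add (integrable_const J)) hω
  simp only [Pi.add_apply] at hI
  rw [integral_add (hint.const_mul _) (integrable_const J), integral_const_mul, heq] at hI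
  simp only [integral_const, probReal_univ, one_smul] at hI
  have : t * (1 + q) * labelMean (1 - q) N (fun l => R.expectedCost (hardInput l)) ≤
      t * (1 + q) * (c * N + α) := by gcongr
  exact hI.trans (add_le_add_left this J)

end RandomizedAlg

end BinPacking

/-! ### Choice of parameters. -/

theorem theorem4 (c : ℝ) (hc : c < 4 - 2 * Real.sqrt 2) :
    ∃ δ : ℝ, 0 < δ ∧
      ∀ (Ω : Type*) [MeasurableSpace Ω] (R : BinPacking.RandomizedAlg Ω) (b : ℕ → ℕ),
        R.IsCompetitive c → R.HasAdviceComplexity b →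
          ∀ᶠ n : ℕ in atTop, δ * (n : ℝ) ≤ (b n : ℝ) := by
  have hs : Real.sqrt 2 * Real.sqrt 2 = 2 := Real.mul_self_sqrt (by norm_num)
  have hs1 : 1 ≤ Real.sqrt 2 := Real.one_le_sqrt.2 (by norm_num)
  have hs2 : Real.sqrt 2 < 3 / 2 := by nlinarith
  set r := Real.sqrt 2
  -- Raising `c` to at least `1` makes it nonnegative and keeps `η / 2` below `1`.
  obtain ⟨d, hcd, hd, hd1⟩ : ∃ d, c ≤ d ∧ d < 4 - 2 * r ∧ 1 ≤ d :=
    ⟨max c 1, le_max_left _ _, max_lt hc (by linarith), le_max_right _ _⟩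
  set η := 4 - 2 * r - d with hη
  have hη0 : 0 < η := by linarith
  refine ⟨η ^ 2 / 16, by positivity, fun Ω _ R b ⟨α, hα⟩ hb => ?_⟩
  have hlog := Real.isLittleO_log_id_atTop.comp_tendsto
    (tendsto_atTop_add_const_right atTop (1 : ℝ) tendsto_natCast_atTop_atTop)
  have hlog' := hlog.bound (show (0 : ℝ) < η ^ 2 / 32 by positivity)
  filter_upwards [hlog', (tendsto_natCast_atTop_atTop (R := ℝ)).eventually_ge_atTop
    (32 / η ^ 2 * (η ^ 2 / 32 + η ^ 2 / 8 + η / 2 * r * |α|))] with n hn hnbig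
  have hα' : ∀ σ, R.expectedCost σ ≤ d * BinPacking.opt σ + |α| := fun σ =>
    (hα σ).trans (by gcongr; exact le_abs_self α)
  -- `q = r - 1` maximizes `q * (1 - q) / (1 + q)`, with value `3 - 2 * r`. With `t = η / 2` the
  -- gain is at least `η ^ 2 / 2 * N`, against a moment loss `t ^ 2 * N = η ^ 2 / 4 * N`.
  have key := BinPacking.RandomizedAlg.advice_lower_bound (q := r - 1) (t := η / 2)
    (N := n / 2) (n := n) (by linarith) hα' hb (by linarith) (by linarith) (by linarith)
    (by linarith) (Nat.mul_div_le n 2)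
  set N : ℝ := ((n / 2 : ℕ) : ℝ)
  have hN0 : 0 ≤ N := Nat.cast_nonneg _
  have hNn : (n : ℝ) ≤ 2 * N + 1 := by
    have : n ≤ 2 * (n / 2) + 1 := by omega
    change (n : ℝ) ≤ 2 * ((n / 2 : ℕ) : ℝ) + 1
    exact_mod_cast this
  have hNn' : N ≤ n := Nat.cast_le.2 (Nat.div_le_self n 2)
  have hlogN : Real.log (N + 1) ≤ η ^ 2 / 32 * (n + 1) := by
    have h1 : Real.log (N + 1) ≤ Real.log (n + 1) := Real.log_le_log (by linarith) (by linarith)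
    simp only [Function.comp, id, Real.norm_eq_abs] at hn
    rw [abs_of_nonneg (show (0 : ℝ) ≤ n + 1 by positivity)] at hn
    exact h1.trans ((le_abs_self _).trans hn)
  have hlog2 : (b n : ℝ) * Real.log 2 ≤ b n := by
    have := Real.log_two_lt_d9
    exact mul_le_of_le_one_right (Nat.cast_nonneg _) (by linarith)
  have hgain : η / 2 * ((1 + (r - 1)) * N + (r - 1) * ((1 - (r - 1)) * N)) =
      η / 2 * (1 + (r - 1)) * (d * N) + η / 2 * r * η * N := by
    rw [hη]; linear_combination (4 - 2 * r - d) / 2 * N * hs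
  have hrη : η ^ 2 / 2 * N ≤ η / 2 * r * η * N := by
    have := mul_le_mul_of_nonneg_left hs1 (show 0 ≤ η ^ 2 / 2 * N by positivity)
    linarith
  have hmain : η ^ 2 / 4 * N ≤ b n + η ^ 2 / 32 * (n + 1) + η / 2 * r * |α| := by
    nlinarith
  -- Since `N` is about `n / 2`, the net gain is about `η ^ 2 / 8 * n`; the logarithm and the
  -- constants each cost at most `η ^ 2 / 32 * n`, leaving `η ^ 2 / 16 * n`.
  have hbig : η ^ 2 / 32 + η ^ 2 / 8 + η / 2 * r * |α| ≤ η ^ 2 / 32 * n := by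
    have := mul_le_mul_of_nonneg_left hnbig (show 0 ≤ η ^ 2 / 32 by positivity)
    rwa [← mul_assoc, show η ^ 2 / 32 * (32 / η ^ 2) = 1 by field_simp, one_mul] at this
  have := mul_le_mul_of_nonneg_left hNn (show 0 ≤ η ^ 2 / 8 by positivity)
  linarith
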